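/- Let $\varphi$ denote Euler's totient function. Fix an even integer $k\ge 0$, and let $(x_n)_{n\ge 1}$ be the sequence of positive integers defined by $$x_{n+2}=\varphi(x_{n+1})+\varphi(x_n)+k\qquad\text{for all integers } n\ge 1,$$ with arbitrary positive integers $x_1,x_2$ as starting values. Then $$\sup_{n\ge 1} x_n\le 4^{X^{3^{k+1}}},\qquad\text{where } X:=\frac{3x_1+5x_2+7k}{2}.$$ In particular, $(x_n)_{n\ge 1}$ is eventually periodic, that is, there exists an integer $T\ge 1$ such that $x_n=x_{n+T}$ for all sufficiently large $n$. -/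

import Mathlib

/-! From index 5 on every term is even, and the halves y satisfy 2y_{n+2} = y_{n+1} + y_n + k -
d_{n+1} - d_n with defects d = y - φ(2y) ≥ 0. Hence S_n = 2y_{n+1} + y_n gains at most k per step,
which settles k = 0. For k > 0, suppose that S passes 4^B for the first time. In the long window
before that, S stays near 4^B, so the defects have small sum, and each difference of y is at most
half the previous one plus a drift term. Thus y ≈ 4^B/3 late in the window, which is no power of
two, and d < √y forces y = 2^b p with p an odd prime and d = 2^b (`totientDefect_cases`).

A pigeonhole over dyadic scales yields t and a long stretch with b < t throughout
(`exists_rare_scale`, `exists_start`). There y mod 2^t determines the defect, so a repeated pair (y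
mod 2^t, difference) makes the differences periodic, and y contains an arithmetic progression of
step e. Here e ≠ 0, since the orbit cannot repeat before a first passage; moreover 2^t ∣ e and |e| <
2^t q for a prime q of order k^2. So q ∤ e, and q divides some term of the progression. That term is
2^b q < 2^t q, far too small (`IsHalfOrbit.false_of_stretch`). -/

/-! ### Totient defects -/

lemma prime_mul_totient_le {p m : ℕ} (hp : p.Prime) (h : p ∣ m) :
    p * Nat.totient m ≤ (p - 1) * m := by
  induction m using Nat.strong_induction_on with
  | _ m ih =>
    obtain ⟨c, rfl⟩ := h
    rcases Nat.eq_zero_or_pos c with rfl | hc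
    · simp
    by_cases hpc : p ∣ c
    · rw [Nat.totient_mul_of_prime_of_dvd hp hpc]
      have := ih c (lt_mul_of_one_lt_left hc hp.one_lt) hpc
      calc p * (p * Nat.totient c) ≤ p * ((p - 1) * c) := Nat.mul_le_mul_left _ this
        _ = _ := by ring
    · rw [Nat.totient_mul_of_prime_of_not_dvd hp hpc]
      calc p * ((p - 1) * Nat.totient c) ≤ p * ((p - 1) * c) := by
            gcongr; exact Nat.totient_le c
        _ = _ := by ring

/-- The amount by which the totient of `2 * y` falls short of `y`. -/
def totientDefect (y : ℕ) : ℕ := y - Nat.totient (2 * y)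

lemma totient_two_mul_le (y : ℕ) : Nat.totient (2 * y) ≤ y := by
  have := prime_mul_totient_le Nat.prime_two (Dvd.intro y rfl)
  omega

lemma totient_two_mul_add_totientDefect (y : ℕ) :
    Nat.totient (2 * y) + totientDefect y = y :=
  Nat.add_sub_cancel' (totient_two_mul_le y)

lemma totientDefect_two_pow_mul (b : ℕ) {m : ℕ} (hm : Odd m) :
    totientDefect (2 ^ b * m) = 2 ^ b * (m - Nat.totient m) := by
  have hc : Nat.Coprime (2 ^ (b + 1)) m := Nat.Coprime.pow_left _ hm.coprime_two_left
  have : 2 * (2 ^ b * m) = 2 ^ (b + 1) * m := by ring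
  rw [totientDefect, this, Nat.totient_mul hc, Nat.totient_prime_pow_succ Nat.prime_two]
  norm_num [Nat.mul_sub]

/-- With p the least prime factor of m, m - φ(m) ≥ m / p ≥ √m. -/
lemma le_sq_sub_totient {m : ℕ} (h1 : 1 < m) (hm : ¬ m.Prime) :
    m ≤ (m - Nat.totient m) ^ 2 := by
  have hp := Nat.minFac_prime h1.ne'
  obtain ⟨c, hc⟩ := Nat.minFac_dvd m
  set p := m.minFac
  have hsq : p ^ 2 ≤ m := Nat.minFac_sq_le_self (by omega) hm
  have hle := prime_mul_totient_le hp (Nat.minFac_dvd m)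
  have hpc : p ≤ c := by
    rw [sq, hc] at hsq
    exact Nat.le_of_mul_le_mul_left hsq hp.pos
  have hcm : c ≤ m - Nat.totient m := by
    have h2 : p * Nat.totient m ≤ p * ((p - 1) * c) := by
      calc _ ≤ (p - 1) * m := hle
        _ = (p - 1) * (p * c) := by rw [← hc]
        _ = _ := by ring
    have h3 := Nat.le_of_mul_le_mul_left h2 hp.pos
    have h4 : (p - 1) * c + c = m := by
      rw [hc, ← Nat.succ_mul, Nat.succ_eq_add_one, Nat.sub_add_cancel hp.one_le]
    omega
  calc m = p * c := hc
    _ ≤ c * c := Nat.mul_le_mul_right _ hpc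
    _ ≤ _ := by rw [sq]; exact Nat.mul_le_mul hcm hcm

/-- The odd part decides: a prime m has m - φ(m) = 1, a composite one has m - φ(m) ≥ √m. -/
lemma totientDefect_cases {y : ℕ} (h0 : y ≠ 0) (h2 : ∀ a, y ≠ 2 ^ a) :
    (∃ b p : ℕ, p.Prime ∧ Odd p ∧ y = 2 ^ b * p ∧ totientDefect y = 2 ^ b) ∨
      y ≤ totientDefect y ^ 2 := by
  obtain ⟨b, m, hm, rfl⟩ := Nat.exists_eq_two_pow_mul_odd h0
  have hm1 : 1 < m := by
    rcases Nat.lt_or_ge 1 m with h' | h'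
    · exact h'
    · obtain rfl : m = 1 := le_antisymm h' hm.pos
      exact absurd (mul_one _) (h2 b)
  rw [totientDefect_two_pow_mul b hm]
  by_cases hp : m.Prime
  · refine Or.inl ⟨b, m, hp, hm, rfl, ?_⟩
    rw [Nat.totient_prime hp, Nat.sub_sub_self hm1.le, mul_one]
  · right
    rw [mul_pow]
    exact Nat.mul_le_mul (Nat.le_self_pow two_ne_zero _) (le_sq_sub_totient hm1 hp)

/-- Two numbers congruent modulo a power of two that exceeds their two-parts have the same
two-part. -/
lemma two_part_eq_of_modEq {t a b p q : ℕ} (ha : a < t) (hb : b < t) (hp : Odd p) (hq : Odd q)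
    (h : 2 ^ a * p ≡ 2 ^ b * q [MOD 2 ^ t]) : a = b := by
  have key : ∀ {a b p q : ℕ}, a < t → b < t → Odd q →
      2 ^ a * p ≡ 2 ^ b * q [MOD 2 ^ t] → a ≤ b := by
    intro a b p q ha hb hq h
    by_contra hlt
    have hd : 2 ^ (b + 1) ∣ 2 ^ a * p := Dvd.dvd.mul_right (pow_dvd_pow 2 (by omega)) _
    have hd' : 2 ^ (b + 1) ∣ 2 ^ b * q :=
      (h.dvd_iff (pow_dvd_pow 2 (by omega : b + 1 ≤ t))).1 hd
    rw [pow_succ] at hd'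
    have := Nat.dvd_of_mul_dvd_mul_left (by positivity) hd'
    exact (Nat.not_even_iff_odd.2 hq) (even_iff_two_dvd.2 this)
  exact le_antisymm (key ha hb hq h) (key hb ha hp h.symm)

/-! ### Sum estimates -/

lemma sum_two_pow_le (d N : ℕ) :
    ∑ t ∈ Finset.range N, (if 2 ^ t ≤ d then 2 ^ t else 0) ≤ 2 * d := by
  -- The first conjunct is needed in the inductive step: when 2 ^ N ≤ d, the earlier powers add up
  -- to less than d.
  have : ∑ t ∈ Finset.range N, (if 2 ^ t ≤ d then 2 ^ t else 0) + 1 ≤ 2 ^ N ∧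
      ∑ t ∈ Finset.range N, (if 2 ^ t ≤ d then 2 ^ t else 0) ≤ 2 * d := by
    induction N with
    | zero => simp
    | succ N ih =>
      rw [Finset.sum_range_succ, pow_succ]
      split_ifs <;> omega
  exact this.2

/-- Each index lies in at most l of the windows. -/
lemma sum_sliding_le {a : ℕ → ℤ} (ha : ∀ i, 0 ≤ a i) (n l : ℕ) :
    ∑ m ∈ Finset.range n, ∑ i ∈ Finset.range l, a (m + i) ≤
      l * ∑ i ∈ Finset.range (n + l), a i := by
  rw [Finset.sum_comm]
  calc _ ≤ ∑ i ∈ Finset.range l, ∑ m ∈ Finset.range (n + l), a m := by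
        refine Finset.sum_le_sum fun i hi => ?_
        have : n + l = i + n + (l - i) := by have := Finset.mem_range.1 hi; omega
        rw [this, Finset.sum_range_add, Finset.sum_range_add]
        have h1 : 0 ≤ ∑ x ∈ Finset.range i, a x := Finset.sum_nonneg fun _ _ => ha _
        have h2 : 0 ≤ ∑ x ∈ Finset.range (l - i), a (i + n + x) :=
          Finset.sum_nonneg fun _ _ => ha _
        have h3 : ∑ m ∈ Finset.range n, a (m + i) = ∑ m ∈ Finset.range n, a (i + m) :=
          Finset.sum_congr rfl fun m _ => by rw [add_comm]
        linarith
    _ = _ := by simp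

/-! ### Half orbits and their potential -/

/-- Sequences satisfying the recurrence of the halves of the even terms. -/
def IsHalfOrbit (k : ℕ) (y : ℕ → ℕ) : Prop :=
  ∀ n, 2 * y (n + 2) + totientDefect (y (n + 1)) + totientDefect (y n) = y (n + 1) + y n + k

/-- The forward difference of a sequence of natural numbers. -/
def fdiff (y : ℕ → ℕ) (n : ℕ) : ℤ := y (n + 1) - y n

/-- The potential that drifts by `k` minus two totient defects. -/
def potential (y : ℕ → ℕ) (n : ℕ) : ℕ := 2 * y (n + 1) + y n

lemma cast_add_fdiff (y : ℕ → ℕ) (n : ℕ) : (y n : ℤ) + fdiff y n = y (n + 1) := by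
  rw [fdiff]; ring

namespace IsHalfOrbit

variable {k : ℕ} {y : ℕ → ℕ}

lemma shift (h : IsHalfOrbit k y) (a : ℕ) : IsHalfOrbit k fun n => y (a + n) :=
  fun n => h (a + n)

lemma two_mul_fdiff (h : IsHalfOrbit k y) (n : ℕ) :
    2 * fdiff y (n + 1) =
      -fdiff y n + ((k : ℤ) - totientDefect (y n) - totientDefect (y (n + 1))) := by
  have := h n
  simp only [fdiff]
  zify at this
  linarith

lemma potential_succ (h : IsHalfOrbit k y) (n : ℕ) :
    potential y (n + 1) + totientDefect (y n) + totientDefect (y (n + 1)) =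
      potential y n + k := by
  have := h n
  simp only [potential, add_assoc, one_add_one_eq_two] at *
  omega

lemma eq_of_repeat (h : IsHalfOrbit k y) {i j : ℕ} (h0 : y i = y j)
    (h1 : y (i + 1) = y (j + 1)) (m : ℕ) :
    y (i + m) = y (j + m) ∧ y (i + m + 1) = y (j + m + 1) := by
  induction m with
  | zero => exact ⟨h0, h1⟩
  | succ m ih =>
    refine ⟨ih.2, ?_⟩
    have h2 := h (i + m)
    have h3 := h (j + m)
    rw [ih.1, ih.2] at h2
    have : 2 * y (i + m + 2) = 2 * y (j + m + 2) := by omega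
    exact Nat.eq_of_mul_eq_mul_left two_pos this

end IsHalfOrbit

/-! ### Arithmetic progressions in stretches with small two-parts -/

lemma exists_lt_dvd_add_mul {q : ℕ} (hq : q.Prime) {e : ℤ} (he : ¬ (q : ℤ) ∣ e) (c : ℤ) :
    ∃ n < q, (q : ℤ) ∣ c + n * e := by
  have := Fact.mk hq
  have he' : (e : ZMod q) ≠ 0 := fun h => he ((ZMod.intCast_zmod_eq_zero_iff_dvd e q).1 h)
  refine ⟨(-(c : ZMod q) / e).val, ZMod.val_lt _, ?_⟩
  rw [← ZMod.intCast_zmod_eq_zero_iff_dvd]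
  push_cast
  rw [ZMod.natCast_zmod_val, div_mul_cancel₀ _ he']
  ring

lemma abs_sub_le_sum_fdiff (y : ℕ → ℕ) {i j l : ℕ} (hij : i ≤ j) (hj : j ≤ l) :
    |(y j : ℤ) - y i| ≤ ∑ m ∈ Finset.range l, |fdiff y m| := by
  calc _ = |∑ m ∈ Finset.Ico i j, fdiff y m| := by
        rw [← Finset.sum_Ico_sub (fun n => (y n : ℤ)) hij]; rfl
    _ ≤ ∑ m ∈ Finset.Ico i j, |fdiff y m| := Finset.abs_sum_le_sum_abs _ _
    _ ≤ _ := Finset.sum_le_sum_of_subset_of_nonneg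
        (fun m hm => Finset.mem_range.2 ((Finset.mem_Ico.1 hm).2.trans_le hj))
        fun _ _ _ => abs_nonneg _

/-- If the total variation is small, then some residue and difference are repeated. -/
lemma exists_repeat_modEq {k t l : ℕ} (hk : 0 < k) (y : ℕ → ℕ) (hl : l = 1024 * k * 2 ^ t)
    (hF : ∑ m ∈ Finset.range l, |fdiff y m| < 64 * k * l) :
    ∃ i j, i < j ∧ j < l ∧ y i ≡ y j [MOD 2 ^ t] ∧ fdiff y i = fdiff y j := by
  classical
  set s := (Finset.range l).filter fun m => |fdiff y m| ≤ 128 * k with hs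
  set b := (Finset.range l).filter fun m => ¬ |fdiff y m| ≤ 128 * k with hb
  have hT : 0 < 2 ^ t := by positivity
  have hcard : s.card + b.card = l := by
    rw [hs, hb, Finset.card_filter_add_card_filter_not, Finset.card_range]
  have hbc : (b.card : ℤ) * (128 * k) ≤ ∑ m ∈ Finset.range l, |fdiff y m| := by
    calc (b.card : ℤ) * (128 * k) = ∑ _m ∈ b, (128 * k : ℤ) := by simp
      _ ≤ ∑ m ∈ b, |fdiff y m| :=
        Finset.sum_le_sum fun m hm => (not_le.1 (Finset.mem_filter.1 hm).2).le
      _ ≤ _ := Finset.sum_le_sum_of_subset_of_nonneg (Finset.filter_subset _ _)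
        fun _ _ _ => abs_nonneg _
  -- Markov's inequality: more than half of the l indices have difference at most 128 k in absolute
  -- value, whereas there are only 2 ^ t * (256 k + 1) < l / 2 possible pairs.
  have hb2 : 2 * b.card < l := by
    have h1 : (k : ℤ) * (2 * b.card) < k * l := by linarith
    exact_mod_cast lt_of_mul_lt_mul_left h1 (by positivity)
  have hkT : 2 ^ t ≤ k * 2 ^ t := Nat.le_mul_of_pos_left _ hk
  set r := Finset.range (2 ^ t) ×ˢ Finset.Icc (-(128 * k : ℤ)) (128 * k) with hr
  have hrc : r.card < s.card := by
    have h1 : r.card = 2 ^ t * (256 * k + 1) := by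
      rw [hr, Finset.card_product, Finset.card_range, Int.card_Icc]
      congr 1
      omega
    have h2 : 2 ^ t * (256 * k + 1) = 256 * (k * 2 ^ t) + 2 ^ t := by ring
    have h3 : 1024 * k * 2 ^ t = 1024 * (k * 2 ^ t) := by ring
    omega
  obtain ⟨i, hi, j, hj, hne, he⟩ := Finset.exists_ne_map_eq_of_card_lt_of_maps_to hrc
    (f := fun m => (y m % 2 ^ t, fdiff y m)) (by
      intro m hm
      have := abs_le.1 (Finset.mem_filter.1 hm).2
      simp only [hr, Finset.coe_product, Set.mem_prod, Finset.mem_coe, Finset.mem_range,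
        Finset.mem_Icc]
      exact ⟨Nat.mod_lt _ hT, this⟩)
  have hil := Finset.mem_range.1 (Finset.mem_filter.1 hi).1
  have hjl := Finset.mem_range.1 (Finset.mem_filter.1 hj).1
  obtain ⟨he1, he2⟩ := Prod.mk.inj he
  rcases lt_or_gt_of_ne hne with h | h
  · exact ⟨i, j, h, hjl, he1, he2⟩
  · exact ⟨j, i, h, hil, he1.symm, he2.symm⟩

/-- Along a stretch where all terms are a power of two below `2 ^ t` times an odd prime, a repeated
residue and difference force the differences to be periodic. -/
lemma IsHalfOrbit.fdiff_periodic {k t l i j : ℕ} {y : ℕ → ℕ} (h : IsHalfOrbit k y)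
    (hform : ∀ m < l, ∃ b p : ℕ, b < t ∧ p.Prime ∧ Odd p ∧ y m = 2 ^ b * p ∧
      totientDefect (y m) = 2 ^ b)
    (hij : i < j) (hmod : y i ≡ y j [MOD 2 ^ t]) (hf : fdiff y i = fdiff y j) (m : ℕ)
    (hm : j + m < l) :
    y (i + m) ≡ y (j + m) [MOD 2 ^ t] ∧ fdiff y (i + m) = fdiff y (j + m) := by
  -- The residue modulo 2 ^ t fixes the two-part, which is the defect.
  have defect_eq : ∀ {a b : ℕ}, a < l → b < l → y a ≡ y b [MOD 2 ^ t] →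
      totientDefect (y a) = totientDefect (y b) := by
    intro a b ha hb hab
    obtain ⟨u, p, hu, -, hp, hyu, hdu⟩ := hform a ha
    obtain ⟨v, q, hv, -, hq, hyv, hdv⟩ := hform b hb
    rw [hyu, hyv] at hab
    rw [hdu, hdv, two_part_eq_of_modEq hu hv hp hq hab]
  induction m with
  | zero => exact ⟨hmod, hf⟩
  | succ m ih =>
    obtain ⟨ih1, ih2⟩ := ih (by omega)
    have hmod' : y (i + m + 1) ≡ y (j + m + 1) [MOD 2 ^ t] := by
      rw [← Int.natCast_modEq_iff, ← cast_add_fdiff, ← cast_add_fdiff, ih2]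
      exact (Int.natCast_modEq_iff.2 ih1).add_right _
    refine ⟨hmod', ?_⟩
    have h1 := h.two_mul_fdiff (i + m)
    have h2 := h.two_mul_fdiff (j + m)
    rw [ih2, defect_eq (by omega) (by omega) ih1, defect_eq (by omega) (by omega) hmod'] at h1
    have : 2 * fdiff y (i + m + 1) = 2 * fdiff y (j + m + 1) := by rw [h1, h2]
    exact mul_left_cancel₀ two_ne_zero this

/-- Periodic differences make the increment of y over one period constant. -/
lemma eq_add_mul_of_fdiff_periodic {l i j : ℕ} {y : ℕ → ℕ} (hij : i < j)
    (hper : ∀ m, j + m < l → fdiff y (i + m) = fdiff y (j + m)) (n : ℕ)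
    (hn : i + n * (j - i) ≤ l) :
    (y (i + n * (j - i)) : ℤ) = y i + n * ((y j : ℤ) - y i) := by
  have hdiff : ∀ m, j + m ≤ l → (y (j + m) : ℤ) - y (i + m) = y j - y i := by
    intro m hm
    induction m with
    | zero => rfl
    | succ m ih =>
      have h1 := cast_add_fdiff y (i + m)
      have h2 := cast_add_fdiff y (j + m)
      have h3 := hper m (by omega)
      have h4 := ih (by omega)
      simp only [← add_assoc]
      linarith
  induction n with
  | zero => simp
  | succ n ih =>
    have he : i + (n + 1) * (j - i) = j + n * (j - i) := by
      rw [add_mul, one_mul]; omega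
    rw [he] at hn ⊢
    have h1 := hdiff _ hn
    have h2 := ih (by omega)
    push_cast
    linarith

/-- There is no long stretch of terms with small two-part times an odd prime, without repetitions
and with a small initial variation. -/
lemma IsHalfOrbit.false_of_stretch {k t l l₁ q : ℕ} {y : ℕ → ℕ} (h : IsHalfOrbit k y)
    (hk : 0 < k) (hl₁ : l₁ = 1024 * k * 2 ^ t) (hq : q.Prime) (hkq : 65536 * k ^ 2 < q)
    (hl : q * l₁ ≤ l)
    (hform : ∀ m < l, ∃ b p : ℕ, b < t ∧ p.Prime ∧ Odd p ∧ y m = 2 ^ b * p ∧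
      totientDefect (y m) = 2 ^ b)
    (hbig : ∀ m < l, 2 ^ t * q ≤ y m)
    (hinj : ∀ i j, i < j → j < l → y i = y j → y (i + 1) ≠ y (j + 1))
    (hF : ∑ m ∈ Finset.range l₁, |fdiff y m| < 64 * k * l₁) : False := by
  obtain ⟨i, j, hij, hj, hmod, hf⟩ := exists_repeat_modEq hk y hl₁ hF
  have hq2 : 2 < q := by nlinarith
  have hlow : 2 * l₁ < l + 1 := by nlinarith
  have hper := h.fdiff_periodic hform hij hmod hf
  set e : ℤ := (y j : ℤ) - y i with he
  have he0 : e ≠ 0 := by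
    intro h0
    have h1 : y i = y j := by omega
    refine hinj i j hij (by omega) h1 ?_
    have h2 := cast_add_fdiff y i
    have h3 := cast_add_fdiff y j
    rw [hf, h1, h3] at h2
    exact_mod_cast h2.symm
  have heT : ((2 ^ t : ℕ) : ℤ) ∣ e := (Nat.modEq_iff_dvd.1 hmod)
  have hqe : ¬ (q : ℤ) ∣ e := by
    intro hdvd
    have hcop : IsCoprime ((2 ^ t : ℕ) : ℤ) (q : ℤ) := by
      rw [Nat.isCoprime_iff_coprime]
      exact Nat.Coprime.pow_left _ ((Nat.coprime_primes Nat.prime_two hq).2 hq2.ne)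
    have h1 : ((2 ^ t : ℕ) : ℤ) * q ≤ |e| :=
      Int.le_of_dvd (abs_pos.2 he0) ((dvd_abs _ _).2 (hcop.mul_dvd heT hdvd))
    have h2 := abs_sub_le_sum_fdiff y hij.le hj.le
    have h3 : (64 * k * l₁ : ℤ) = (2 ^ t : ℕ) * (65536 * k ^ 2 : ℕ) := by
      rw [hl₁]; push_cast; ring
    have h4 : ((2 ^ t : ℕ) : ℤ) * (65536 * k ^ 2 : ℕ) ≤ (2 ^ t : ℕ) * q := by
      exact_mod_cast Nat.mul_le_mul_left _ hkq.le
    linarith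
  obtain ⟨n, hn, hdvd⟩ := exists_lt_dvd_add_mul hq hqe (y i)
  have hpos : i + n * (j - i) < l := by
    obtain ⟨q', rfl⟩ : ∃ q', q = q' + 2 := ⟨q - 2, by omega⟩
    have h1 : n * (j - i) ≤ (q' + 1) * (j - i) := Nat.mul_le_mul_right _ (by omega)
    have h2 : q' * (j - i) ≤ q' * l₁ := Nat.mul_le_mul_left _ (by omega)
    have h3 : (q' + 1) * (j - i) = q' * (j - i) + (j - i) := by ring
    have h4 : (q' + 2) * l₁ = q' * l₁ + 2 * l₁ := by ring
    omega
  rw [← eq_add_mul_of_fdiff_periodic hij (fun m hm => (hper m hm).2) n hpos.le,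
    Int.natCast_dvd_natCast] at hdvd
  obtain ⟨b, p, hb, hp, hpo, hy, -⟩ := hform _ hpos
  have hbig' := hbig _ hpos
  rw [hy] at hdvd hbig'
  have hqp : q = p := by
    rcases hq.dvd_mul.1 hdvd with h1 | h1
    · have := (Nat.prime_dvd_prime_iff_eq hq Nat.prime_two).1 (hq.dvd_of_dvd_pow h1)
      omega
    · exact (Nat.prime_dvd_prime_iff_eq hq hp).1 h1
  rw [← hqp] at hbig'
  have := Nat.le_of_mul_le_mul_right hbig' hq.pos
  exact absurd this (not_le.2 (Nat.pow_lt_pow_right one_lt_two hb))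

/-! ### Selecting a scale and a starting point -/

/-- Dyadic pigeonhole: some dyadic scale is rarely exceeded. -/
lemma exists_rare_scale {N V C : ℕ} (hN : 0 < N) (d : ℕ → ℕ)
    (hd : ∑ m ∈ Finset.range V, d m ≤ C) :
    ∃ t < N, N * (2 ^ t * ∑ m ∈ Finset.range V, if 2 ^ t ≤ d m then 1 else 0) ≤ 2 * C := by
  have hsum : ∑ t ∈ Finset.range N,
      (N * (2 ^ t * ∑ m ∈ Finset.range V, if 2 ^ t ≤ d m then 1 else 0)) ≤
      ∑ _t ∈ Finset.range N, 2 * C := by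
    rw [← Finset.mul_sum, Finset.sum_const, Finset.card_range, smul_eq_mul]
    refine Nat.mul_le_mul_left _ ?_
    simp only [Finset.mul_sum, mul_ite, mul_one, mul_zero]
    rw [Finset.sum_comm]
    calc _ ≤ ∑ m ∈ Finset.range V, 2 * d m := Finset.sum_le_sum fun m _ => sum_two_pow_le _ _
      _ ≤ _ := by rw [← Finset.mul_sum]; omega
  obtain ⟨t, ht, h⟩ := Finset.exists_le_of_sum_le ⟨0, Finset.mem_range.2 hN⟩ hsum
  exact ⟨t, Finset.mem_range.1 ht, h⟩

/-- Some starting point sees small variation and no indicated event. -/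
lemma exists_start {V l l₁ k : ℕ} (hk : 0 < k) (hl₁ : 0 < l₁) (hl₁l : l₁ ≤ l) (hl : 2 * l ≤ V)
    {f g : ℕ → ℤ} (hf : ∀ m, 0 ≤ f m) (hg : ∀ m, 0 ≤ g m)
    (hF : ∑ m ∈ Finset.range V, f m ≤ 16 * k * V)
    (hG : 8 * l * ∑ m ∈ Finset.range V, g m ≤ V) :
    ∃ n, n + l ≤ V ∧ ∑ i ∈ Finset.range l₁, f (n + i) < 64 * k * l₁ ∧
      ∑ i ∈ Finset.range l, g (n + i) < 1 := by
  obtain ⟨W, rfl⟩ : ∃ W, V = W + l := ⟨V - l, by omega⟩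
  have hmono : ∑ i ∈ Finset.range (W + l₁), f i ≤ ∑ i ∈ Finset.range (W + l), f i :=
    Finset.sum_le_sum_of_subset_of_nonneg
      (Finset.range_mono (by omega)) fun _ _ _ => hf _
  have h1 := sum_sliding_le hf W l₁
  have h2 := sum_sliding_le hg W l
  have h3 : (l₁ : ℤ) * ∑ i ∈ Finset.range (W + l₁), f i ≤ l₁ * (16 * k * (W + l : ℕ)) :=
    mul_le_mul_of_nonneg_left (hmono.trans hF) (by positivity)
  have hkl : (0 : ℤ) < k * l₁ := by positivity
  have h4 : 64 * (k * l₁ : ℤ) * (l * ∑ m ∈ Finset.range (W + l), g m) ≤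
      8 * (k * l₁) * (W + l : ℕ) := by
    have := mul_le_mul_of_nonneg_left hG (by positivity : (0 : ℤ) ≤ 8 * (k * l₁))
    linarith
  -- The weight 64 k l₁ on g lets one average control both sums. The average is below the weight
  -- because 16 + 8 = 24 and V = W + l ≤ 2 W.
  have hsum : ∑ n ∈ Finset.range W, (∑ i ∈ Finset.range l₁, f (n + i) +
      64 * (k * l₁ : ℤ) * ∑ i ∈ Finset.range l, g (n + i)) <
      ∑ _n ∈ Finset.range W, 64 * (k * l₁ : ℤ) := by
    rw [Finset.sum_add_distrib, ← Finset.mul_sum, Finset.sum_const, Finset.card_range,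
      nsmul_eq_mul]
    have h5 : 64 * (k * l₁ : ℤ) * ∑ n ∈ Finset.range W, ∑ i ∈ Finset.range l, g (n + i) ≤
        64 * (k * l₁ : ℤ) * (l * ∑ m ∈ Finset.range (W + l), g m) :=
      mul_le_mul_of_nonneg_left h2 (by positivity)
    have h6 : 24 * (k * l₁ : ℤ) * (W + l : ℕ) < 64 * (k * l₁ : ℤ) * W := by
      have : (24 : ℤ) * (W + l : ℕ) < 64 * W := by push_cast; omega
      nlinarith
    linarith
  obtain ⟨n, hn, hlt⟩ := Finset.exists_lt_of_sum_lt hsum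
  have hn' := Finset.mem_range.1 hn
  have hf0 : 0 ≤ ∑ i ∈ Finset.range l₁, f (n + i) := Finset.sum_nonneg fun _ _ => hf _
  have hg0 : 0 ≤ ∑ i ∈ Finset.range l, g (n + i) := Finset.sum_nonneg fun _ _ => hg _
  refine ⟨n, by omega, ?_, ?_⟩
  · have : 0 ≤ 64 * (k * l₁ : ℤ) * ∑ i ∈ Finset.range l, g (n + i) := by positivity
    linarith
  · by_contra hge
    have := mul_le_mul_of_nonneg_left (not_lt.1 hge) (by positivity : (0 : ℤ) ≤ 64 * (k * l₁))
    linarith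

/-- There is no long stretch of terms of the form power of two times an odd prime, without
repetitions and with bounded average variation and defect. -/
lemma IsHalfOrbit.false_of_long_stretch {k V N : ℕ} {y : ℕ → ℕ} (h : IsHalfOrbit k y)
    (hk : 0 < k) (hN : N = 2 ^ 32 * k ^ 4) (hV : 2 * (2 ^ 27 * k ^ 3 * 2 ^ N) ≤ V)
    (hform : ∀ m < V, ∃ b p : ℕ, p.Prime ∧ Odd p ∧ y m = 2 ^ b * p ∧
      totientDefect (y m) = 2 ^ b)
    (hbig : ∀ m < V, 2 ^ N * (2 ^ 17 * k ^ 2) ≤ y m)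
    (hinj : ∀ i j, i < j → j < V → y i = y j → y (i + 1) ≠ y (j + 1))
    (hD : ∑ m ∈ Finset.range V, totientDefect (y m) ≤ 2 * k * V)
    (hF : ∑ m ∈ Finset.range V, |fdiff y m| ≤ 16 * k * V) : False := by
  have hN0 : 0 < N := by rw [hN]; positivity
  obtain ⟨t, htN, ht⟩ := exists_rare_scale hN0 (fun m => totientDefect (y m)) hD
  -- Here 65536 k ^ 2 is the variation bound 64 k l₁ divided by 2 ^ t.
  obtain ⟨q, hq, hkq, hq2⟩ := Nat.exists_prime_lt_and_le_two_mul (65536 * k ^ 2) (by positivity)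
  have hq3 : q ≤ 2 ^ 17 * k ^ 2 := by omega
  set l₁ := 1024 * k * 2 ^ t with hl₁
  have hl₁0 : 0 < l₁ := by positivity
  have hlL : q * l₁ ≤ 2 ^ 27 * k ^ 3 * 2 ^ t := by
    calc q * l₁ ≤ (2 ^ 17 * k ^ 2) * l₁ := Nat.mul_le_mul_right _ hq3
      _ = _ := by rw [hl₁]; ring
  have hLN : 2 ^ 27 * k ^ 3 * 2 ^ t ≤ 2 ^ 27 * k ^ 3 * 2 ^ N :=
    Nat.mul_le_mul_left _ (Nat.pow_le_pow_right two_pos htN.le)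
  set σ := ∑ m ∈ Finset.range V, if 2 ^ t ≤ totientDefect (y m) then 1 else 0 with hσ
  -- N is chosen as 8 * 2 ^ 27 k ^ 3 * 4 k, so that the factor k and the length of the stretch are
  -- absorbed.
  have hrare : 8 * (q * l₁) * σ ≤ V := by
    have h1 : 4 * k * (8 * (2 ^ 27 * k ^ 3 * 2 ^ t) * σ) ≤ 4 * k * V := by
      calc _ = N * (2 ^ t * σ) := by rw [hN]; ring
        _ ≤ 2 * (2 * k * V) := ht
        _ = _ := by ring
    have h2 := Nat.le_of_mul_le_mul_left h1 (by positivity)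
    refine le_trans ?_ h2
    gcongr
  obtain ⟨n, hn, hvar, hev⟩ := exists_start (V := V) (l := q * l₁) hk hl₁0
    (Nat.le_mul_of_pos_left _ hq.pos) (by omega)
    (f := fun m => |fdiff y m|) (g := fun m => if 2 ^ t ≤ totientDefect (y m) then 1 else 0)
    (fun _ => abs_nonneg _) (fun m => by split_ifs <;> norm_num) hF (by
      rw [hσ] at hrare; exact_mod_cast hrare)
  refine (h.shift n).false_of_stretch (t := t) (l := q * l₁) hk hl₁ hq hkq le_rfl ?_ ?_ ?_ hvar
  · intro m hm
    obtain ⟨b, p, hp, ho, hy, hd⟩ := hform (n + m) (by omega)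
    refine ⟨b, p, ?_, hp, ho, hy, hd⟩
    by_contra hb
    have h1 : (1 : ℤ) ≤ if 2 ^ t ≤ totientDefect (y (n + m)) then 1 else 0 := by
      rw [if_pos]
      rw [hd]
      exact Nat.pow_le_pow_right two_pos (not_lt.1 hb)
    have h2 := Finset.single_le_sum
      (f := fun i => if 2 ^ t ≤ totientDefect (y (n + i)) then (1 : ℤ) else 0)
      (fun i _ => by split_ifs <;> norm_num) (Finset.mem_range.2 hm)
    exact absurd (h1.trans h2) (not_le.2 hev)
  · intro m hm
    refine le_trans ?_ (hbig (n + m) (by omega))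
    exact Nat.mul_le_mul (Nat.pow_le_pow_right two_pos htN.le) hq3
  · intro i j hij hj
    exact hinj (n + i) (n + j) (by omega) (by omega)

/-! ### First passage of the potential -/

namespace IsHalfOrbit

variable {k : ℕ} {y : ℕ → ℕ}

lemma potential_add_sum (h : IsHalfOrbit k y) (n : ℕ) :
    potential y n + ∑ i ∈ Finset.range n, (totientDefect (y i) + totientDefect (y (i + 1))) =
      potential y 0 + k * n := by
  induction n with
  | zero => simp
  | succ n ih =>
    have := h.potential_succ n
    rw [Finset.sum_range_succ, mul_add, mul_one]
    omega

lemma potential_add_le (h : IsHalfOrbit k y) (a n : ℕ) :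
    potential y (a + n) ≤ potential y a + k * n := by
  have := (h.shift a).potential_add_sum n
  simp only [potential, add_zero, zero_add, add_assoc] at this ⊢
  omega

/-- Over a window of 2 V steps, V = 2 ^ (B - k - 2), the potential gains less than 2 ^ (B - 1), the
square root of 4 ^ (B - 1). -/
lemma two_mul_mul_two_pow_lt {k B : ℕ} (h : k + 2 ≤ B) :
    2 * (k * 2 ^ (B - k - 2)) < 2 ^ (B - 1) := by
  have h1 : 2 ^ (B - 1) = 2 * (2 ^ k * 2 ^ (B - k - 2)) := by
    rw [← pow_add, ← pow_succ']; congr 1; omega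
  rw [h1]
  exact Nat.mul_lt_mul_of_pos_left
    (Nat.mul_lt_mul_of_pos_right Nat.lt_two_pow_self (by positivity)) two_pos

/-- The one-step drift of the potential. -/
def drift (k : ℕ) (y : ℕ → ℕ) (n : ℕ) : ℤ :=
  (k : ℤ) - totientDefect (y n) - totientDefect (y (n + 1))

lemma two_mul_abs_fdiff_succ_le (h : IsHalfOrbit k y) (n : ℕ) :
    2 * |fdiff y (n + 1)| ≤ |fdiff y n| + |drift k y n| := by
  have := h.two_mul_fdiff n
  calc 2 * |fdiff y (n + 1)| = |2 * fdiff y (n + 1)| := by rw [abs_mul]; simp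
    _ = |-fdiff y n + drift k y n| := by rw [this]; rfl
    _ ≤ _ := by simpa using abs_add_le (-fdiff y n) (drift k y n)

/-- The recurrence for differences contracts by 1/2, so the initial difference is forgotten
exponentially fast. -/
lemma two_pow_mul_abs_fdiff_le (h : IsHalfOrbit k y) (n : ℕ) :
    2 ^ n * |fdiff y n| ≤ |fdiff y 0| + 2 ^ n * ∑ i ∈ Finset.range n, |drift k y i| := by
  induction n with
  | zero => simp
  | succ n ih =>
    have h1 := h.two_mul_abs_fdiff_succ_le n
    have h2 : (0 : ℤ) < 2 ^ n := by positivity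
    have h3 := mul_le_mul_of_nonneg_left h1 h2.le
    have h4 : 0 ≤ ∑ i ∈ Finset.range n, |drift k y i| :=
      Finset.sum_nonneg fun _ _ => abs_nonneg _
    have h5 : 0 ≤ 2 ^ n * ∑ i ∈ Finset.range n, |drift k y i| := by positivity
    have h6 : 0 ≤ 2 ^ n * |drift k y n| := by positivity
    rw [Finset.sum_range_succ, pow_succ]
    linarith

lemma sum_abs_fdiff_le (h : IsHalfOrbit k y) (n : ℕ) :
    ∑ i ∈ Finset.range n, |fdiff y i| ≤
      2 * |fdiff y 0| + ∑ i ∈ Finset.range n, |drift k y i| := by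
  -- The extra term 2 |f_n| pays for the next difference and makes the induction close.
  have : ∑ i ∈ Finset.range n, |fdiff y i| + 2 * |fdiff y n| ≤
      2 * |fdiff y 0| + ∑ i ∈ Finset.range n, |drift k y i| := by
    induction n with
    | zero => simp
    | succ n ih =>
      have := h.two_mul_abs_fdiff_succ_le n
      rw [Finset.sum_range_succ, Finset.sum_range_succ]
      linarith
  linarith [abs_nonneg (fdiff y n)]

/-- A window ending with the first passage of the potential above `4 ^ B` is contradictory. -/
lemma false_of_first_passage (h : IsHalfOrbit k y) (hk : 0 < k) {B V : ℕ}
    (hB : 2 ^ 34 * k ^ 4 ≤ B) (hV : V = 2 ^ (B - k - 2))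
    (hlow : ∀ i < 2 * V, potential y i ≤ 4 ^ B) (hhigh : 4 ^ B < potential y (2 * V)) :
    False := by
  have hkk : k ≤ k ^ 4 := Nat.le_self_pow (by norm_num) k
  have hVpos : 0 < V := by rw [hV]; positivity
  set N := 2 ^ 32 * k ^ 4 with hN
  have hNB : N + 28 + 3 * k ≤ B - k - 2 := by omega
  have hk2 : k < 2 ^ k := Nat.lt_two_pow_self
  have hkV : 2 * (k * V) < 2 ^ (B - 1) := hV ▸ two_mul_mul_two_pow_lt (by omega)
  have h4B : 4 ^ B = 4 * 4 ^ (B - 1) := by rw [← pow_succ']; congr 1; omega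
  have hsq : (2 ^ (B - 1)) ^ 2 = 4 ^ (B - 1) := by rw [← pow_mul, mul_comm, pow_mul]; norm_num
  have hlarge : 64 ≤ 2 ^ (B - 1) := by
    calc 64 = 2 ^ 6 := by norm_num
      _ ≤ _ := Nat.pow_le_pow_right two_pos (by omega)
  have hDsum : ∑ i ∈ Finset.range (2 * V), (totientDefect (y i) + totientDefect (y (i + 1))) <
      2 * (k * V) := by
    have h1 := h.potential_add_sum (2 * V)
    have h2 := hlow 0 (by omega)
    have h3 : k * (2 * V) = 2 * (k * V) := by ring
    omega
  have hD : ∀ i < 2 * V, totientDefect (y i) < 2 * (k * V) := fun i hi =>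
    ((Nat.le_add_right _ _).trans (Finset.single_le_sum
      (f := fun i => totientDefect (y i) + totientDefect (y (i + 1)))
      (fun _ _ => Nat.zero_le _) (Finset.mem_range.2 hi))).trans_lt hDsum
  have hdrift : ∑ i ∈ Finset.range (2 * V), |drift k y i| ≤ 4 * (k * V : ℤ) := by
    have h1 : ∀ i, |drift k y i| ≤
        k + ((totientDefect (y i) + totientDefect (y (i + 1)) : ℕ) : ℤ) := by
      intro i
      rw [drift, abs_le]
      push_cast
      constructor <;> linarith [Int.natCast_nonneg (totientDefect (y i)),
        Int.natCast_nonneg (totientDefect (y (i + 1))), Int.natCast_nonneg k]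
    calc _ ≤ ∑ i ∈ Finset.range (2 * V),
          ((k : ℤ) + ((totientDefect (y i) + totientDefect (y (i + 1)) : ℕ) : ℤ)) :=
          Finset.sum_le_sum fun i _ => h1 i
      _ ≤ _ := by
        rw [Finset.sum_add_distrib, ← Nat.cast_sum, Finset.sum_const, Finset.card_range,
          nsmul_eq_mul]
        have : ((∑ i ∈ Finset.range (2 * V),
          (totientDefect (y i) + totientDefect (y (i + 1))) : ℕ) : ℤ) < (2 * (k * V) : ℕ) := by
          exact_mod_cast hDsum
        push_cast at this ⊢
        linarith
  -- The potential ends above 4 ^ B and climbs at most k per step, so it cannot have been much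
  -- lower.
  have hSlow : ∀ i < 2 * V, 4 ^ B ≤ potential y i + 2 * (k * V) := by
    intro i hi
    have h1 := h.potential_add_le i (2 * V - i)
    rw [Nat.add_sub_cancel' hi.le] at h1
    have h2 : k * (2 * V - i) ≤ k * (2 * V) := Nat.mul_le_mul_left _ (Nat.sub_le _ _)
    have h3 : k * (2 * V) = 2 * (k * V) := by ring
    omega
  have h2V : 4 ^ B ≤ 2 ^ V := by
    rw [show (4 : ℕ) = 2 ^ 2 from rfl, ← pow_mul]
    refine Nat.pow_le_pow_right two_pos ?_
    obtain ⟨c, hc⟩ : ∃ c, B - k - 2 = c + 3 := ⟨B - k - 5, by omega⟩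
    have h1 : c < 2 ^ c := Nat.lt_two_pow_self
    rw [hV, hc, pow_add]
    omega
  have hf0 : |fdiff y 0| ≤ 4 ^ B := by
    have h1 := hlow 0 (by omega)
    simp only [potential] at h1
    zify at h1
    rw [fdiff, abs_le]
    constructor <;> linarith [Int.natCast_nonneg (y 0), Int.natCast_nonneg (y (0 + 1))]
  -- Past the first half of the window, the initial difference, at most 4 ^ B ≤ 2 ^ V, contributes
  -- at most 1.
  have hf : ∀ i, V ≤ i → i < 2 * V → |fdiff y i| ≤ 1 + 4 * (k * V : ℤ) := by
    intro i hi hi2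
    have h1 := h.two_pow_mul_abs_fdiff_le i
    have h2 : ∑ j ∈ Finset.range i, |drift k y j| ≤ 4 * (k * V : ℤ) :=
      (Finset.sum_le_sum_of_subset_of_nonneg (Finset.range_mono hi2.le)
        fun _ _ _ => abs_nonneg _).trans hdrift
    have h3 : (4 : ℤ) ^ B ≤ 2 ^ i := by
      exact_mod_cast h2V.trans (Nat.pow_le_pow_right two_pos hi)
    have h4 : (0 : ℤ) < 2 ^ i := by positivity
    have h5 := mul_le_mul_of_nonneg_left h2 h4.le
    refine le_of_mul_le_mul_left ?_ h4
    linarith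
  -- The potential is 3 y_i plus twice a small difference, so y_i is close to 4 ^ B / 3, strictly
  -- between consecutive powers of two.
  have hy : ∀ i, V ≤ i → i < 2 * V → 4 ^ (B - 1) < y i ∧ y i < 2 * 4 ^ (B - 1) := by
    intro i hi hi2
    have h1 := abs_le.1 (hf i hi hi2)
    have h2 := hSlow i hi2
    have h3 := hlow i hi2
    have h4 : 64 * 2 ^ (B - 1) ≤ 4 ^ (B - 1) := by
      rw [← hsq, sq]; exact Nat.mul_le_mul_right _ hlarge
    simp only [potential, fdiff] at h1 h2 h3
    rw [h4B] at h2 h3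
    zify at h2 h3 h4 hkV hlarge ⊢
    constructor <;> linarith [h1.1, h1.2]
  refine (h.shift V).false_of_long_stretch (V := V) hk rfl ?_ ?_ ?_ ?_ ?_ ?_
  · have h1 : k ^ 3 ≤ (2 ^ k) ^ 3 := Nat.pow_le_pow_left hk2.le 3
    calc 2 * (2 ^ 27 * k ^ 3 * 2 ^ N) ≤ 2 * (2 ^ 27 * (2 ^ k) ^ 3 * 2 ^ N) := by gcongr
      _ = 2 ^ (N + 28 + 3 * k) := by ring
      _ ≤ V := by rw [hV]; exact Nat.pow_le_pow_right two_pos hNB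
  · intro m hm
    obtain ⟨hy1, hy2⟩ := hy (V + m) (by omega) (by omega)
    have hd := hD (V + m) (by omega)
    rcases totientDefect_cases (y := y (V + m)) (by omega) (by
      intro a ha
      rw [ha, show (4 : ℕ) = 2 ^ 2 from rfl, ← pow_mul] at hy1
      rw [ha, show (4 : ℕ) = 2 ^ 2 from rfl, ← pow_mul, ← pow_succ'] at hy2
      have h1 := (Nat.pow_lt_pow_iff_right one_lt_two).1 hy1
      have h2 := (Nat.pow_lt_pow_iff_right one_lt_two).1 hy2
      omega) with h1 | h1
    · exact h1
    · have h2 : totientDefect (y (V + m)) ^ 2 ≤ (2 ^ (B - 1)) ^ 2 :=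
        Nat.pow_le_pow_left (by omega) 2
      omega
  · intro m hm
    have h1 : k ^ 2 ≤ (2 ^ k) ^ 2 := Nat.pow_le_pow_left hk2.le 2
    calc 2 ^ N * (2 ^ 17 * k ^ 2) ≤ 2 ^ N * (2 ^ 17 * (2 ^ k) ^ 2) := by gcongr
      _ = 2 ^ (N + 17 + 2 * k) := by ring
      _ ≤ 2 ^ (B - 1) := Nat.pow_le_pow_right two_pos (by omega)
      _ ≤ 4 ^ (B - 1) := Nat.pow_le_pow_left (by norm_num) _
      _ ≤ _ := (hy (V + m) (by omega) (by omega)).1.le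
  -- After a repetition the passage value would already occur j - i steps before the end of the
  -- window.
  · intro i j hij hj h0 h1
    obtain ⟨e1, e2⟩ := h.eq_of_repeat h0 h1 (V - j)
    have h2 := hlow (V + i + (V - j)) (by omega)
    have h3 : V + j + (V - j) = 2 * V := by omega
    rw [h3] at e1 e2
    simp only [potential] at h2 hhigh
    omega
  · have h1 : ∑ i ∈ Finset.range V, totientDefect (y (V + i)) ≤
        ∑ i ∈ Finset.range (2 * V), (totientDefect (y i) + totientDefect (y (i + 1))) := by
      rw [two_mul, Finset.sum_range_add _ V V]
      refine le_trans ?_ (Nat.le_add_left _ _)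
      exact Finset.sum_le_sum fun i _ => Nat.le_add_right _ _
    linarith
  · have h1 := (h.shift V).sum_abs_fdiff_le V
    have h2 : |fdiff (fun n => y (V + n)) 0| ≤ 1 + 4 * (k * V : ℤ) := hf V le_rfl (by omega)
    have h3 : ∑ i ∈ Finset.range V, |drift k (fun n => y (V + n)) i| ≤ 4 * (k * V : ℤ) := by
      refine le_trans ?_ hdrift
      rw [two_mul, Finset.sum_range_add _ V V]
      exact le_add_of_nonneg_left (Finset.sum_nonneg fun _ _ => abs_nonneg _)
    have h4 : (1 : ℤ) ≤ k * V := by exact_mod_cast Nat.mul_pos hk hVpos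
    linarith

lemma potential_le (h : IsHalfOrbit k y) (hk : 0 < k) {B : ℕ} (hB : 2 ^ 34 * k ^ 4 ≤ B)
    (h0 : 2 * potential y 0 ≤ 4 ^ B) (n : ℕ) : potential y n ≤ 4 ^ B := by
  by_contra hn
  have hex : ∃ n, 4 ^ B < potential y n := ⟨n, not_le.1 hn⟩
  classical
  obtain ⟨hfind, hmin⟩ := And.intro (Nat.find_spec hex) fun m => Nat.find_min hex (m := m)
  set n₀ := Nat.find hex
  have hkk : k ≤ k ^ 4 := Nat.le_self_pow (by norm_num) k
  have hkV : 2 * (k * 2 ^ (B - k - 2)) < 2 ^ (B - 1) := two_mul_mul_two_pow_lt (by omega)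
  have hB2 : 2 * 2 ^ (B - 1) ≤ 4 ^ B := by
    rw [← pow_succ', Nat.sub_add_cancel (by omega)]
    exact Nat.pow_le_pow_left (by norm_num) _
  -- The potential starts at most at half of 4 ^ B, so its climb takes at least 2 V steps.
  have hle : 2 * 2 ^ (B - k - 2) ≤ n₀ := by
    by_contra hlt
    have h1 := h.potential_add_le 0 n₀
    rw [zero_add] at h1
    have h2 : k * n₀ ≤ k * (2 * 2 ^ (B - k - 2)) := Nat.mul_le_mul_left _ (by omega)
    have h3 : k * (2 * 2 ^ (B - k - 2)) = 2 * (k * 2 ^ (B - k - 2)) := by ring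
    omega
  obtain ⟨a, ha⟩ := Nat.exists_eq_add_of_le' hle
  refine (h.shift a).false_of_first_passage hk hB rfl ?_ ?_
  · intro i hi
    exact not_lt.1 (hmin (a + i) (by omega))
  · rw [ha] at hfind
    exact hfind

end IsHalfOrbit

/-! ### Periodicity, and passage from the recurrence to half orbits -/

lemma eventually_periodic_of_bounded {g : ℕ → ℕ → ℕ} {x : ℕ → ℕ} {C : ℕ}
    (hrec : ∀ n, 1 ≤ n → x (n + 2) = g (x (n + 1)) (x n)) (hC : ∀ n, 1 ≤ n → x n ≤ C) :
    ∃ T : ℕ, 1 ≤ T ∧ ∀ᶠ n : ℕ in Filter.atTop, x n = x (n + T) := by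
  obtain ⟨i, j, hne, he⟩ := Finite.exists_ne_map_eq_of_infinite
    fun n : ℕ => ((⟨x (n + 1), Nat.lt_succ_of_le (hC _ (by omega))⟩ : Fin (C + 1)),
      (⟨x (n + 2), Nat.lt_succ_of_le (hC _ (by omega))⟩ : Fin (C + 1)))
  simp only [Prod.mk.injEq, Fin.mk.injEq] at he
  wlog hij : i < j generalizing i j
  · exact this j i hne.symm ⟨he.1.symm, he.2.symm⟩ (by omega)
  have key : ∀ m, x (i + 1 + m) = x (j + 1 + m) ∧ x (i + 1 + m + 1) = x (j + 1 + m + 1) := by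
    intro m
    induction m with
    | zero => exact he
    | succ m ih =>
      refine ⟨ih.2, ?_⟩
      have h1 := hrec (i + 1 + m) (by omega)
      have h2 := hrec (j + 1 + m) (by omega)
      rw [ih.1, ih.2, ← h2] at h1
      exact h1
  refine ⟨j - i, by omega, Filter.eventually_atTop.2 ⟨i + 1, fun n hn => ?_⟩⟩
  obtain ⟨m, rfl⟩ := Nat.exists_eq_add_of_le hn
  have : i + 1 + m + (j - i) = j + 1 + m := by omega
  rw [this]
  exact (key m).1

section Recurrence

variable {k : ℕ} {x : ℕ → ℕ}

lemma pos_of_rec (h1 : 1 ≤ x 1) (h2 : 1 ≤ x 2)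
    (hrec : ∀ n : ℕ, 1 ≤ n → x (n + 2) = Nat.totient (x (n + 1)) + Nat.totient (x n) + k)
    (n : ℕ) : 1 ≤ x (n + 1) ∧ 1 ≤ x (n + 2) := by
  induction n with
  | zero => exact ⟨h1, h2⟩
  | succ n ih =>
    refine ⟨ih.2, ?_⟩
    have h3 := hrec (n + 1) (by omega)
    have h4 : 0 < Nat.totient (x (n + 1 + 1)) := Nat.totient_pos.2 ih.2
    rw [h3]
    omega

lemma even_of_rec (hk : Even k) (h1 : 1 ≤ x 1) (h2 : 1 ≤ x 2)
    (hrec : ∀ n : ℕ, 1 ≤ n → x (n + 2) = Nat.totient (x (n + 1)) + Nat.totient (x n) + k)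
    (n : ℕ) : Even (x (n + 5)) := by
  have hpos : ∀ n, 1 ≤ n → 1 ≤ x n := by
    intro n hn
    obtain ⟨m, rfl⟩ := Nat.exists_eq_add_of_le' hn
    exact (pos_of_rec h1 h2 hrec m).1
  have hone : ∀ {m : ℕ}, 1 ≤ m → (Nat.totient m = 1 ↔ m ≤ 2) := by
    intro m hm
    rw [Nat.totient_eq_one_iff]
    omega
  have hφ : ∀ n, 1 ≤ n → 1 ≤ Nat.totient (x n) := fun n hn => Nat.totient_pos.2 (hpos n hn)
  -- For k > 0 neither side holds. For k = 0 a term at most 2 forces the two totients before it to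
  -- be 1, so the next term is 2. Hence φ(x_{n+3}) and φ(x_{n+4}) have equal parity.
  have hiff : x (n + 3) ≤ 2 ↔ x (n + 4) ≤ 2 := by
    have e3 := hrec (n + 1) (by omega)
    have e4 := hrec (n + 2) (by omega)
    have p1 := hφ (n + 1) (by omega)
    have p2 := hφ (n + 2) (by omega)
    have p3 := hφ (n + 3) (by omega)
    have q3 := hone (hpos (n + 3) (by omega))
    obtain ⟨r, rfl⟩ := hk
    simp only [add_assoc] at e3 e4
    norm_num at e3 e4
    omega
  have e5 := hrec (n + 3) (by omega)
  simp only [add_assoc] at e5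
  norm_num at e5
  rw [e5, ← add_assoc]
  refine Even.add ?_ hk
  rcases Nat.lt_or_ge 2 (x (n + 3)) with h | h
  · exact (Nat.totient_even (by omega)).add (Nat.totient_even h)
  · rw [(hone (hpos (n + 3) (by omega))).2 h, (hone (hpos (n + 4) (by omega))).2 (hiff.1 h)]
    decide

lemma isHalfOrbit_of_rec (hk : Even k) (h1 : 1 ≤ x 1) (h2 : 1 ≤ x 2)
    (hrec : ∀ n : ℕ, 1 ≤ n → x (n + 2) = Nat.totient (x (n + 1)) + Nat.totient (x n) + k) :
    IsHalfOrbit k fun n => x (n + 5) / 2 := by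
  intro n
  have hev : ∀ m, 2 * (x (m + 5) / 2) = x (m + 5) := fun m =>
    Nat.two_mul_div_two_of_even (even_of_rec hk h1 h2 hrec m)
  have hr := hrec (n + 5) (by omega)
  have d0 := totient_two_mul_add_totientDefect (x (n + 5) / 2)
  have d1 := totient_two_mul_add_totientDefect (x (n + 1 + 5) / 2)
  have e2 := hev (n + 2)
  rw [hev] at d0 d1
  simp only [add_right_comm n _ 5] at *
  omega

/-- The coefficients 3, 5, 7 come from iterating x_{n+2} ≤ x_{n+1} + x_n + k up to x_6. -/
lemma initial_le_of_rec
    (hrec : ∀ n : ℕ, 1 ≤ n → x (n + 2) = Nat.totient (x (n + 1)) + Nat.totient (x n) + k)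
    (n : ℕ) (hn : 1 ≤ n) (hn6 : n ≤ 6) : x n ≤ 3 * x 1 + 5 * x 2 + 7 * k := by
  have hle : ∀ n, 1 ≤ n → x (n + 2) ≤ x (n + 1) + x n + k := fun n hn => by
    rw [hrec n hn]
    have h1 := Nat.totient_le (x (n + 1))
    have h2 := Nat.totient_le (x n)
    omega
  have e3 := hle 1 (by omega)
  have e4 := hle 2 (by omega)
  have e5 := hle 3 (by omega)
  have e6 := hle 4 (by omega)
  norm_num at e3 e4 e5 e6
  interval_cases n <;> omega

lemma le_four_pow_of_rec (hk : Even k) (h1 : 1 ≤ x 1) (h2 : 1 ≤ x 2)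
    (hrec : ∀ n : ℕ, 1 ≤ n → x (n + 2) = Nat.totient (x (n + 1)) + Nat.totient (x n) + k)
    (n : ℕ) (hn : 1 ≤ n) :
    x n ≤ 4 ^ ((3 * x 1 + 5 * x 2 + 7 * k) / 2) ^ 3 ^ (k + 1) := by
  set Y := (3 * x 1 + 5 * x 2 + 7 * k) / 2 with hY
  set B := Y ^ 3 ^ (k + 1) with hB
  have hy := isHalfOrbit_of_rec hk h1 h2 hrec
  have hinit := initial_le_of_rec hrec
  have hY4 : 4 ≤ Y := by omega
  have hYB : Y ≤ B := Nat.le_self_pow (by positivity) Y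
  have h4B : 8 * Y + 8 ≤ 4 ^ B := by
    refine le_trans ?_ (Nat.pow_le_pow_right (by norm_num) hYB)
    obtain ⟨c, hc⟩ := Nat.exists_eq_add_of_le' hY4
    rw [hc, pow_add]
    have : c < 4 ^ c := Nat.lt_pow_self (by norm_num)
    omega
  have hpot0 : 2 * potential (fun n => x (n + 5) / 2) 0 ≤ 4 ^ B := by
    have h5 := hinit 5 (by omega) (by omega)
    have h6 := hinit 6 (by omega) (by omega)
    simp only [potential]
    norm_num
    omega
  have hpot : ∀ n, potential (fun n => x (n + 5) / 2) n ≤ 4 ^ B := by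
    rcases Nat.eq_zero_or_pos k with rfl | hkpos
    · intro n
      have := hy.potential_add_le 0 n
      rw [zero_add] at this
      omega
    -- An even k > 0 is at least 2, whence 3 ^ (k + 1) ≥ 27 and Y ≥ 11; this is ample for 2 ^ 34 k ^
    -- 4 ≤ B.
    · refine hy.potential_le hkpos ?_ hpot0
      obtain ⟨r, hr⟩ := hk
      have hY11 : 11 ≤ Y := by omega
      have hkY : k ≤ Y := by omega
      have h27 : 27 ≤ 3 ^ (k + 1) := by
        calc 27 = 3 ^ 3 := by norm_num
          _ ≤ _ := Nat.pow_le_pow_right (by norm_num) (by omega)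
      calc 2 ^ 34 * k ^ 4 ≤ 11 ^ 23 * k ^ 4 := Nat.mul_le_mul_right _ (by norm_num)
        _ ≤ Y ^ 23 * Y ^ 4 := by gcongr
        _ = Y ^ 27 := by ring
        _ ≤ B := Nat.pow_le_pow_right (by omega) h27
  rcases Nat.lt_or_ge n 6 with hn6 | hn6
  · have := hinit n hn (by omega)
    omega
  · obtain ⟨m, rfl⟩ := Nat.exists_eq_add_of_le' hn6
    have h3 := hpot m
    have h4 := Nat.two_mul_div_two_of_even (even_of_rec hk h1 h2 hrec (m + 1))
    simp only [potential, add_assoc] at h3 h4 ⊢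
    norm_num at h3 h4 ⊢
    omega

end Recurrence

theorem theorem2 (k : ℕ) (hk : Even k) (x : ℕ → ℕ) (h1 : 1 ≤ x 1) (h2 : 1 ≤ x 2)
    (hrec : ∀ n : ℕ, 1 ≤ n →
      x (n + 2) = Nat.totient (x (n + 1)) + Nat.totient (x n) + k)
    (X : ℝ) (hX : X = (3 * (x 1 : ℝ) + 5 * (x 2 : ℝ) + 7 * (k : ℝ)) / 2) :
    (∀ n : ℕ, 1 ≤ n → (x n : ℝ) ≤ (4 : ℝ) ^ (X ^ (3 ^ (k + 1) : ℕ) : ℝ)) ∧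
    (∃ T : ℕ, 1 ≤ T ∧ ∀ᶠ n : ℕ in Filter.atTop, x n = x (n + T)) := by
  have hbound := le_four_pow_of_rec hk h1 h2 hrec
  refine ⟨fun n hn => ?_, eventually_periodic_of_bounded (g := fun a b =>
    Nat.totient a + Nat.totient b + k) hrec hbound⟩
  set Y := (3 * x 1 + 5 * x 2 + 7 * k) / 2 with hY
  have hYX : (Y : ℝ) ≤ X := by
    rw [hX, hY]
    exact_mod_cast Nat.cast_div_le (α := ℝ) (m := 3 * x 1 + 5 * x 2 + 7 * k) (n := 2)
  calc (x n : ℝ) ≤ ((4 ^ Y ^ 3 ^ (k + 1) : ℕ) : ℝ) := Nat.cast_le.2 (hbound n hn)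
    _ = (4 : ℝ) ^ ((Y : ℝ) ^ (3 ^ (k + 1) : ℕ) : ℝ) := by
      rw [← Nat.cast_pow Y, Real.rpow_natCast]; push_cast; rfl
    _ ≤ _ := Real.rpow_le_rpow_of_exponent_le (by norm_num)
      (pow_le_pow_left₀ (Nat.cast_nonneg _) hYX _)
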